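/- Conventions. A ranked alphabet is a finite nonempty set $\Sigma$ of symbols, each $\sigma\in\Sigma$ having a rank in $\mathbb N$; $\Sigma^{(k)}$ is the set of symbols of rank $k$. For a set $U$, $T_\Sigma(U)$ is the set of finite trees whose inner nodes and leaves are labelled by symbols of $\Sigma$ (a symbol of rank $k$ having exactly $k$ ordered subtrees) or, at leaves only, by elements of $U$. Put $X_k=\{x_1,\dots,x_k\}$ and $T_\Sigma=T_\Sigma(\emptyset)$. For $t\in T_\Sigma(X_k)$, $t[s_1,\dots,s_k]$ is the result of substituting $s_i$ for each occurrence of $x_i$ in $t$. A context-free tree grammar over $\Sigma$ is a tuple $G=(N,\Sigma,\eta_0,P)$ with a ranked alphabet $N$ of nonterminals disjoint from $\Sigma$, an axiom $\eta_0\in T_{N\cup\Sigma}$, and a finite set $P$ of productions $A(x_1,\dots,x_k)\to t$ with $k \in \mathbb N$, $A\in N^{(k)}$ and $t\in T_{N\cup\Sigma}(X_k)$. A derivation step $\eta\Rightarrow_G\zeta$ replaces one occurrence of a subtree $A(\tau_1,\dots,\tau_k)$ of $\eta$ by $t[\tau_1,\dots,\tau_k]$, for some production $A(x_1,\dots,x_k)\to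 t$ in $P$. The tree language of $G$ is $\mathcal L(G)=\{t\in T_\Sigma : \eta_0\Rightarrow_G^* t\}$. The grammar $G$ is linear if in the right-hand side of every production each variable occurs at most once, and monadic if every nonterminal has rank $0$ or $1$. A set $L\subseteq T_\Sigma$ is a linear monadic context-free tree language if $L=\mathcal L(G)$ for some linear monadic context-free tree grammar $G$ over $\Sigma$. A tree homomorphism $h$ from $\Sigma$ to $\Delta$ (ranked alphabets) assigns to each $\sigma\in\Sigma^{(k)}$, $k\in\mathbb N$, a tree $h(\sigma)\in T_\Delta(X_k)$; it extends to trees by $h(x)=x$ for variables $x$ and $h(\sigma(t_1,\dots,t_k))=h(\sigma)[h(t_1),\dots,h(t_k)]$. It is linear if for every $\sigma\in\Sigma$ each variable occurs at most once in $h(\sigma)$. Theorem. The class of linear monadic context-free tree languages is closed under inverse linear tree homomorphisms: for all ranked alphabets $\Sigma,\Delta$, every linear tree homomorphism $h$ from $\Sigma$ to $\Delta$, and every linear monadic context-free tree language $L\subseteq T_\Delta$, the set $h^{-1}(L)=\{t\in T_\Sigma : h(t)\in L\}$ is a linear monadic context-free tree language. -/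

import Mathlib

universe u v w

/-- A ranked alphabet: a finite nonempty set of symbols, each with a rank. -/
structure RankedAlphabet where
  Sym : Type u
  rank : Sym → ℕ
  finite_sym : Finite Sym
  nonempty_sym : Nonempty Sym

/-- The disjoint union of two ranked alphabets. -/
def RankedAlphabet.disjSum (N : RankedAlphabet.{u}) (T : RankedAlphabet.{v}) :
    RankedAlphabet.{max u v} where
  Sym := N.Sym ⊕ T.Sym
  rank := Sum.elim N.rank T.rank
  finite_sym := by
    have := N.finite_sym
    have := T.finite_sym
    infer_instance
  nonempty_sym := N.nonempty_sym.elim fun a => ⟨Sum.inl a⟩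

/-- Trees over the ranked alphabet `T` indexed by the set `U`.
The variables `x_1, …, x_k` are represented by the elements of `Fin k`,
so `RTree T (Fin k)` is the set of trees over `T` with variables in `{x_1, …, x_k}`. -/
inductive RTree (T : RankedAlphabet.{u}) (U : Type w) : Type (max u w)
  | var (x : U) : RTree T U
  | node (s : T.Sym) (ts : Fin (T.rank s) → RTree T U) : RTree T U

/-- Trees without variables; a tree language over `T` is a set of ground trees. -/
abbrev GroundTree (T : RankedAlphabet.{u}) : Type u := RTree T (Fin 0)

namespace RTree

/-- Simultaneous substitution of `f x` for every occurrence of every variable `x`. -/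
def subst {T : RankedAlphabet.{u}} {U : Type v} {V : Type w} (f : U → RTree T V) :
    RTree T U → RTree T V
  | var x => f x
  | node s ts => node s fun i => subst f (ts i)

/-- The number of occurrences of the variable `x` in a tree. -/
def count {T : RankedAlphabet.{u}} {U : Type w} [DecidableEq U] (x : U) : RTree T U → ℕ
  | var y => if y = x then 1 else 0
  | node _ ts => ∑ i, count x (ts i)

/-- Every variable occurs at most once. -/
def IsLinear {T : RankedAlphabet.{u}} {U : Type w} [DecidableEq U] (t : RTree T U) : Prop :=
  ∀ x : U, t.count x ≤ 1

/-- A tree over the terminal alphabet `T`, seen as a tree over nonterminals and terminals. -/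
def ofTerminal (N : RankedAlphabet.{u}) {T : RankedAlphabet.{v}} {U : Type w} :
    RTree T U → RTree (N.disjSum T) U
  | var x => var x
  | node s ts => node (T := N.disjSum T) (Sum.inr s) fun i => ofTerminal N (ts i)

end RTree

/-- A production `A(x_1, …, x_k) → rhs`, where `k` is the rank of the nonterminal `A`. -/
structure CFTProduction (N : RankedAlphabet.{u}) (T : RankedAlphabet.{v}) where
  lhs : N.Sym
  rhs : RTree (N.disjSum T) (Fin (N.rank lhs))

/-- Context-free tree grammars over the terminal alphabet `T`. -/
structure CFTG (T : RankedAlphabet.{v}) where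
  nonterminals : RankedAlphabet.{0}
  axiomTree : GroundTree (nonterminals.disjSum T)
  productions : Set (CFTProduction nonterminals T)
  finite_productions : productions.Finite

namespace CFTG

/-- Every right-hand side contains each variable at most once. -/
def IsLinear {T : RankedAlphabet.{v}} (G : CFTG T) : Prop :=
  ∀ p ∈ G.productions, p.rhs.IsLinear

/-- Every nonterminal has rank zero or one. -/
def IsMonadic {T : RankedAlphabet.{v}} (G : CFTG T) : Prop :=
  ∀ A : G.nonterminals.Sym, G.nonterminals.rank A ≤ 1

/-- One derivation step: for some production `A(x_1, …, x_k) → t` and some `κ` containing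
`x_{m+1}` exactly once, `η = κ[x_1, …, x_m, A(τ_1, …, τ_k)]` and
`ζ = κ[x_1, …, x_m, t[τ_1, …, τ_k]]`. -/
def Step {T : RankedAlphabet.{v}} (G : CFTG T) {m : ℕ}
    (η ζ : RTree (G.nonterminals.disjSum T) (Fin m)) : Prop :=
  ∃ p ∈ G.productions,
    ∃ κ : RTree (G.nonterminals.disjSum T) (Fin (m + 1)),
    ∃ τ : Fin (G.nonterminals.rank p.lhs) → RTree (G.nonterminals.disjSum T) (Fin m),
      κ.count (Fin.last m) = 1 ∧
      η = κ.subst (Fin.lastCases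
        (RTree.node (T := G.nonterminals.disjSum T) (Sum.inl p.lhs) τ) RTree.var) ∧
      ζ = κ.subst (Fin.lastCases (p.rhs.subst τ) RTree.var)

/-- The ground terminal trees that can be derived from the axiom. -/
def language {T : RankedAlphabet.{v}} (G : CFTG T) : Set (GroundTree T) :=
  {t | Relation.ReflTransGen G.Step G.axiomTree (t.ofTerminal G.nonterminals)}

end CFTG

/-- Tree languages generated by some linear monadic context-free tree grammar. -/
def IsLinearMonadicCFTL {T : RankedAlphabet.{v}} (L : Set (GroundTree T)) : Prop :=
  ∃ G : CFTG T, G.IsLinear ∧ G.IsMonadic ∧ G.language = L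

/-- A tree homomorphism, given by a tree over `D` in the variables `x_1, …, x_k`
for every symbol of rank `k`. -/
def TreeHom (S : RankedAlphabet.{u}) (D : RankedAlphabet.{v}) : Type (max u v) :=
  (s : S.Sym) → RTree D (Fin (S.rank s))

namespace TreeHom

/-- The extension of a tree homomorphism to trees; variables are left fixed. -/
def apply {S : RankedAlphabet.{u}} {D : RankedAlphabet.{v}} (h : TreeHom S D) {U : Type w} :
    RTree S U → RTree D U
  | .var x => .var x
  | .node s ts => (h s).subst fun i => apply h (ts i)

/-- The image of each symbol contains each variable at most once, i.e. the map sending the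
`i`-th variable occurrence (from left to right) to its variable is injective. -/
def IsLinear {S : RankedAlphabet.{u}} {D : RankedAlphabet.{v}} (h : TreeHom S D) : Prop :=
  ∀ s : S.Sym, (h s).IsLinear

end TreeHom

/-! Linear monadic grammars have the same power as pushdown tree systems, where a stack is passed on
to at most one child (`isLinearMonadicCFTL_iff`). It therefore suffices to build a pushdown tree
system that reads `t` while simulating a given system `P` on `h t`.

Within the image `h s`, a run of `P` carries its stack from the root along a single path, until it
reaches a variable or drops the stack. The effect on the stack is described by the word of changes
of the top state at the reads on this path; its length is at most the height of `h s`. Every side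
branch starts with a one-state stack and ends in the same two ways, so it imposes at most one demand
on a variable: to be generated by a state `q` after executing a word `p`. As `h` is linear, each
variable receives at most one demand, and a deleted variable none. Thus finitely many data describe
the run inside `h s` (`Reads.gen`, `exists_reads`).

The new system reads `s` in one step and lets the inheriting child execute the word afterwards. If
the stack is dropped, no child can do this, so `s` and the demands are announced and the word is
executed before `s` is read. The unfinished word accompanies the top of the stack: a state stores
its present residue and the residue guessed for the moment of its popping. The two inclusions are
`achieves_of_gen` and `exists_gen`. -/

namespace RTree

/-! ### Substitution and occurrences of variables -/

theorem subst_subst {T : RankedAlphabet.{u}} {U V W : Type*} (f : U → RTree T V)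
    (g : V → RTree T W) (t : RTree T U) :
    (t.subst f).subst g = t.subst fun x => (f x).subst g := by
  induction t with
  | var x => rfl
  | node s ts ih => simp only [subst, ih]

theorem subst_var {T : RankedAlphabet.{u}} {U : Type*} (t : RTree T U) : t.subst var = t := by
  induction t with
  | var x => rfl
  | node s ts ih => simp only [subst, ih]

theorem subst_congr_of_count {T : RankedAlphabet.{u}} {U V : Type*} [DecidableEq U]
    {f g : U → RTree T V} {t : RTree T U} (h : ∀ x, t.count x ≠ 0 → f x = g x) :
    t.subst f = t.subst g := by
  induction t with
  | var x => exact h x (by simp [count])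
  | node s ts ih =>
    simp only [subst]
    congr 1
    funext i
    refine ih i fun x hx => h x ?_
    simp only [count]
    intro h0
    exact hx (Finset.sum_eq_zero_iff.1 h0 i (Finset.mem_univ i))

theorem count_subst_var_eq_zero {T : RankedAlphabet.{u}} {U V : Type*} [DecidableEq V]
    (f : U → V) {y : V} (hy : ∀ x, f x ≠ y) (t : RTree T U) :
    (t.subst fun x => var (f x)).count y = 0 := by
  induction t with
  | var x => simp [subst, count, hy x]
  | node s ts ih => simp [subst, count, ih]

theorem count_le_node {T : RankedAlphabet.{u}} {U : Type*} [DecidableEq U] {s : T.Sym}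
    (ts : Fin (T.rank s) → RTree T U) (x : U) (i : Fin (T.rank s)) :
    (ts i).count x ≤ (node s ts).count x := by
  simp only [count]
  exact Finset.single_le_sum (f := fun i => (ts i).count x) (fun _ _ => Nat.zero_le _)
    (Finset.mem_univ i)

theorem IsLinear.child {T : RankedAlphabet.{u}} {U : Type*} [DecidableEq U] {s : T.Sym}
    {ts : Fin (T.rank s) → RTree T U} (h : (node s ts).IsLinear) (i : Fin (T.rank s)) :
    (ts i).IsLinear :=
  fun x => (count_le_node ts x i).trans (h x)

/-- In a linear tree no variable occurs in two different direct subtrees. -/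
theorem IsLinear.child_unique {T : RankedAlphabet.{u}} {U : Type*} [DecidableEq U] {s : T.Sym}
    {ts : Fin (T.rank s) → RTree T U} (h : (node s ts).IsLinear) {x : U} {i j : Fin (T.rank s)}
    (hi : (ts i).count x ≠ 0) (hj : (ts j).count x ≠ 0) : i = j := by
  by_contra hij
  have h1 := h x
  have h2 : ∑ k ∈ {i, j}, (ts k).count x ≤ ∑ k, (ts k).count x :=
    Finset.sum_le_sum_of_subset (Finset.subset_univ _)
  rw [Finset.sum_pair hij] at h2
  simp only [count] at h1
  omega

end RTree

/-! ### Big-step semantics of context-free tree grammars -/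

namespace CFTG

variable {T : RankedAlphabet.{v}} (G : CFTG T)

/-- Outermost big-step semantics: `G.Gen ξ t` says that the sentential form `ξ` generates the
ground terminal tree `t`. -/
inductive Gen {U : Type w} : RTree (G.nonterminals.disjSum T) U → GroundTree T → Prop
  | terminal (s : T.Sym) (ξ : Fin (T.rank s) → RTree (G.nonterminals.disjSum T) U)
      (ts : Fin (T.rank s) → GroundTree T) (h : ∀ i, Gen (ξ i) (ts i)) :
      Gen (RTree.node (T := G.nonterminals.disjSum T) (Sum.inr s) ξ) (RTree.node s ts)
  | nonterminal (p : CFTProduction G.nonterminals T) (hp : p ∈ G.productions)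
      (τ : Fin (G.nonterminals.rank p.lhs) → RTree (G.nonterminals.disjSum T) U)
      (t : GroundTree T) (h : Gen (p.rhs.subst τ) t) :
      Gen (RTree.node (T := G.nonterminals.disjSum T) (Sum.inl p.lhs) τ) t

/-- Parallel rewriting. -/
inductive Par {U : Type w} : RTree (G.nonterminals.disjSum T) U →
    RTree (G.nonterminals.disjSum T) U → Prop
  | refl (ξ : RTree (G.nonterminals.disjSum T) U) : Par ξ ξ
  | node (s : (G.nonterminals.disjSum T).Sym)
      (ξ ζ : Fin ((G.nonterminals.disjSum T).rank s) → RTree (G.nonterminals.disjSum T) U)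
      (h : ∀ i, Par (ξ i) (ζ i)) : Par (RTree.node s ξ) (RTree.node s ζ)
  | production (p : CFTProduction G.nonterminals T) (hp : p ∈ G.productions)
      (τ : Fin (G.nonterminals.rank p.lhs) → RTree (G.nonterminals.disjSum T) U) :
      Par (RTree.node (T := G.nonterminals.disjSum T) (Sum.inl p.lhs) τ) (p.rhs.subst τ)

variable {G}

theorem Par.subst {U V : Type*} {f g : U → RTree (G.nonterminals.disjSum T) V}
    (h : ∀ x, G.Par (f x) (g x)) (t : RTree (G.nonterminals.disjSum T) U) :
    G.Par (t.subst f) (t.subst g) := by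
  induction t with
  | var x => exact h x
  | node s ts ih => exact .node s _ _ ih

/-- Parallel rewriting makes the induction work: a production may copy or delete an argument, and a
rewriting inside that argument is then carried over to all copies by `Par.subst`. -/
theorem Gen.of_par {U : Type*} {ζ : RTree (G.nonterminals.disjSum T) U} {t : GroundTree T}
    (h : G.Gen ζ t) : ∀ {η}, G.Par η ζ → G.Gen η t := by
  induction h with
  | terminal s ξ ts h ih =>
    intro η hη
    generalize hζ : RTree.node (T := G.nonterminals.disjSum T) (Sum.inr s) ξ = ζ at hη
    cases hη with
    | refl => exact hζ ▸ .terminal s ξ ts h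
    | node s' ξ' ζ' h' =>
      cases hζ
      exact .terminal s ξ' ts fun i => ih i (h' i)
    | production p hp τ => exact .nonterminal p hp τ _ (hζ ▸ .terminal s ξ ts h)
  | nonterminal p hp τ t h ih =>
    intro η hη
    generalize hζ : RTree.node (T := G.nonterminals.disjSum T) (Sum.inl p.lhs) τ = ζ at hη
    cases hη with
    | refl => exact hζ ▸ .nonterminal p hp τ t h
    | node s' ξ' ζ' h' =>
      cases hζ
      exact .nonterminal p hp ξ' t (ih (.subst h' _))
    | production p' hp' τ' =>
      exact .nonterminal p' hp' τ' _ (hζ ▸ .nonterminal p hp τ t h)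

theorem Step.par {m : ℕ} {η ζ : RTree (G.nonterminals.disjSum T) (Fin m)} (h : G.Step η ζ) :
    G.Par η ζ := by
  obtain ⟨p, hp, κ, τ, -, rfl, rfl⟩ := h
  refine .subst (fun x => ?_) κ
  induction x using Fin.lastCases with
  | last => simpa using .production p hp τ
  | cast x => simpa using .refl _

theorem Gen.ofTerminal (t : GroundTree T) :
    G.Gen ((t.ofTerminal G.nonterminals)) t := by
  induction t with
  | var x => exact x.elim0
  | node s ts ih => exact .terminal s _ ts ih

theorem Step.production {m : ℕ} {p : CFTProduction G.nonterminals T} (hp : p ∈ G.productions)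
    (τ : Fin (G.nonterminals.rank p.lhs) → RTree (G.nonterminals.disjSum T) (Fin m)) :
    G.Step (RTree.node (T := G.nonterminals.disjSum T) (Sum.inl p.lhs) τ) (p.rhs.subst τ) :=
  ⟨p, hp, .var (Fin.last m), τ, by simp [RTree.count], by simp [RTree.subst],
    by simp [RTree.subst]⟩

theorem Step.node {m : ℕ} {s : (G.nonterminals.disjSum T).Sym}
    {ξ : Fin ((G.nonterminals.disjSum T).rank s) → RTree (G.nonterminals.disjSum T) (Fin m)}
    {i : Fin ((G.nonterminals.disjSum T).rank s)} {η ζ : RTree (G.nonterminals.disjSum T) (Fin m)}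
    (h : G.Step η ζ) :
    G.Step (RTree.node s (Function.update ξ i η)) (RTree.node s (Function.update ξ i ζ)) := by
  obtain ⟨p, hp, κ, τ, hκ, rfl, rfl⟩ := h
  -- The hole is the last variable; `castSucc` keeps the siblings free of it.
  refine ⟨p, hp, RTree.node s (Function.update
    (fun j => (ξ j).subst fun x => .var x.castSucc) i κ), τ, ?_, ?_, ?_⟩
  · simp only [RTree.count]
    rw [Finset.sum_eq_single i]
    · simpa using hκ
    · intro j _ hj
      rw [Function.update_of_ne hj]
      exact RTree.count_subst_var_eq_zero _ (fun x => (Fin.castSucc_lt_last x).ne) _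
    · simp
  all_goals
    simp only [RTree.subst]
    congr 1
    funext j
    by_cases hj : j = i
    · subst hj
      simp
    · simp [Function.update_of_ne hj, RTree.subst_subst, RTree.subst, RTree.subst_var]

theorem steps_node {m : ℕ} (s : (G.nonterminals.disjSum T).Sym)
    {ξ ζ : Fin ((G.nonterminals.disjSum T).rank s) → RTree (G.nonterminals.disjSum T) (Fin m)}
    (h : ∀ i, Relation.ReflTransGen G.Step (ξ i) (ζ i)) :
    Relation.ReflTransGen G.Step (RTree.node s ξ) (RTree.node s ζ) := by
  -- The children are rewritten one after the other; `F` is the set of those already finished.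
  have key : ∀ F : Finset (Fin ((G.nonterminals.disjSum T).rank s)),
      Relation.ReflTransGen G.Step (RTree.node s ξ)
        (RTree.node s fun j => if j ∈ F then ζ j else ξ j) := by
    intro F
    induction F using Finset.induction_on with
    | empty => simpa using .refl
    | insert i F hi ih =>
      refine ih.trans ?_
      have := Relation.ReflTransGen.lift (p := G.Step)
        (fun η => RTree.node s (Function.update (fun j => if j ∈ F then ζ j else ξ j) i η))
        (fun _ _ hs => Step.node hs) _ _ (h i)
      convert this using 2
      · funext j
        by_cases hj : j = i
        · subst hj; simp [hi]
        · simp [hj]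
      · funext j
        by_cases hj : j = i
        · subst hj; simp
        · simp [hj]
  simpa using key Finset.univ

theorem Gen.steps {m : ℕ} {ξ : RTree (G.nonterminals.disjSum T) (Fin m)} {t : GroundTree T}
    (h : G.Gen ξ t) :
    Relation.ReflTransGen G.Step ξ
      ((t.ofTerminal G.nonterminals).subst fun x : Fin 0 => x.elim0) := by
  induction h with
  | terminal s ξ ts h ih => exact steps_node (G := G) (Sum.inr s) ih
  | nonterminal p hp τ t h ih => exact .head (.production hp τ) ih

theorem mem_language_iff {t : GroundTree T} : t ∈ G.language ↔ G.Gen G.axiomTree t := by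
  constructor
  · intro h
    change Relation.ReflTransGen G.Step _ _ at h
    generalize G.axiomTree = η at h ⊢
    induction h using Relation.ReflTransGen.head_induction_on with
    | refl => exact .ofTerminal t
    | head hs _ ih => exact ih.of_par hs.par
  · intro h
    have := h.steps
    rwa [show (fun x : Fin 0 => x.elim0) = RTree.var (T := G.nonterminals.disjSum T) from
      funext fun x => x.elim0, RTree.subst_var] at this

/-- `Gen` has no rule for variables, so an outermost derivation never meets one. This serves to pass
between `Fin 0` and `Fin 1`. -/
theorem Gen.subst {U V : Type*} (f : U → RTree (G.nonterminals.disjSum T) V)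
    {ξ : RTree (G.nonterminals.disjSum T) U} {t : GroundTree T} (h : G.Gen ξ t) :
    G.Gen (ξ.subst f) t := by
  induction h with
  | terminal s ξ ts h ih => exact .terminal s _ ts ih
  | nonterminal p hp τ t h ih =>
    refine .nonterminal p hp _ t ?_
    rwa [RTree.subst_subst] at ih

end CFTG

/-! ### Pushdown tree systems -/

/-- A pushdown tree system over `T` with set of states `Q`. Its configurations are stacks of
states; when a symbol is read, at most one child inherits the stack below the top state. -/
structure PushdownTreeSystem (T : RankedAlphabet.{v}) (Q : Type w) where
  start : Q
  pop : Q → Prop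
  move : Q → Q → Prop
  push : Q → Q → Q → Prop
  read : Q → (s : T.Sym) → Option (Fin (T.rank s)) → (Fin (T.rank s) → Q) → Prop

namespace PushdownTreeSystem

variable {T : RankedAlphabet.{v}} {Q : Type w}

/-- `P.Gen l t` says that the stack `l` (top first) generates the ground tree `t`. -/
inductive Gen (P : PushdownTreeSystem T Q) : List Q → GroundTree T → Prop
  | pop {q l t} (hq : P.pop q) (h : Gen P l t) : Gen P (q :: l) t
  | move {q a l t} (hq : P.move q a) (h : Gen P (a :: l) t) : Gen P (q :: l) t
  | push {q a b l t} (hq : P.push q a b) (h : Gen P (a :: b :: l) t) : Gen P (q :: l) t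
  | read {q s i qs l} {ts : Fin (T.rank s) → GroundTree T} (hq : P.read q s i qs)
      (h : ∀ j, Gen P (qs j :: if i = some j then l else []) (ts j)) :
      Gen P (q :: l) (RTree.node s ts)

def language (P : PushdownTreeSystem T Q) : Set (GroundTree T) :=
  {t | P.Gen [P.start] t}

theorem not_gen_nil (P : PushdownTreeSystem T Q) (t : GroundTree T) : ¬ P.Gen [] t := by
  intro h
  cases h

/-- Transport along an equivalence of state sets. -/
def congr {Q' : Type*} (e : Q ≃ Q') (P : PushdownTreeSystem T Q) : PushdownTreeSystem T Q' where
  start := e P.start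
  pop q := P.pop (e.symm q)
  move q a := P.move (e.symm q) (e.symm a)
  push q a b := P.push (e.symm q) (e.symm a) (e.symm b)
  read q s i qs := P.read (e.symm q) s i fun j => e.symm (qs j)

theorem Gen.congr {Q' : Type*} (e : Q ≃ Q') {P : PushdownTreeSystem T Q} {l : List Q}
    {t : GroundTree T} (h : P.Gen l t) : (P.congr e).Gen (l.map e) t := by
  induction h with
  | pop hq h ih => exact .pop (by simpa [PushdownTreeSystem.congr] using hq) ih
  | move hq h ih => exact .move (by simpa [PushdownTreeSystem.congr] using hq) ih
  | push hq h ih => exact .push (by simpa [PushdownTreeSystem.congr] using hq) ih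
  | @read q s i qs l ts hq h ih =>
    refine .read (i := i) (qs := fun j => e (qs j))
      (by simpa [PushdownTreeSystem.congr] using hq) fun j => ?_
    have := ih j
    rw [List.map_cons] at this
    split_ifs at this ⊢ <;> exact this

theorem language_congr {Q' : Type*} (e : Q ≃ Q') (P : PushdownTreeSystem T Q) :
    (P.congr e).language = P.language := by
  ext t
  constructor
  · intro h
    have := Gen.congr e.symm h
    simpa [PushdownTreeSystem.congr, language] using this
  · exact fun h => Gen.congr e h

/-! ### From pushdown tree systems to grammars -/

section Grammar

variable {Q : Type} [Finite Q] (P : PushdownTreeSystem T Q)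

/-- A unary nonterminal for every state, and a nullary nonterminal for the empty stack. -/
def stackAlphabet (Q : Type) [Finite Q] : RankedAlphabet.{0} where
  Sym := Option Q
  rank q := q.elim 0 fun _ => 1
  finite_sym := inferInstance
  nonempty_sym := inferInstance

/-- The empty stack as a tree. -/
def bottom {U : Type*} : RTree ((stackAlphabet Q).disjSum T) U :=
  .node (T := (stackAlphabet Q).disjSum T) (Sum.inl none) fun i : Fin 0 => i.elim0

/-- The state `q` on top of the stack `ξ`. -/
def cons {U : Type*} (q : Q) (ξ : RTree ((stackAlphabet Q).disjSum T) U) :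
    RTree ((stackAlphabet Q).disjSum T) U :=
  .node (T := (stackAlphabet Q).disjSum T) (Sum.inl (some q)) fun _ : Fin 1 => ξ

/-- A stack as a tree. -/
def ofStack {U : Type*} : List Q → RTree ((stackAlphabet Q).disjSum T) U
  | [] => bottom
  | q :: l => cons q (ofStack l)

def production (q : Q) (ξ : RTree ((stackAlphabet Q).disjSum T) (Fin 1)) :
    CFTProduction (stackAlphabet Q) T where
  lhs := some q
  rhs := ξ

/-- Only the inheriting child contains the variable, whence linearity; the others end in `bottom`,
for which there is no production. -/
def readTree (s : T.Sym) (i : Option (Fin (T.rank s))) (qs : Fin (T.rank s) → Q) :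
    RTree ((stackAlphabet Q).disjSum T) (Fin 1) :=
  .node (T := (stackAlphabet Q).disjSum T) (Sum.inr s) fun j : Fin (T.rank s) =>
    cons (qs j) (if i = some j then .var 0 else bottom)

inductive IsProduction : CFTProduction (stackAlphabet Q) T → Prop
  | pop {q} (h : P.pop q) : IsProduction (production q (.var 0))
  | move {q a} (h : P.move q a) : IsProduction (production q (cons a (.var 0)))
  | push {q a b} (h : P.push q a b) : IsProduction (production q (cons a (cons b (.var 0))))
  | read {q s i qs} (h : P.read q s i qs) : IsProduction (production q (readTree s i qs))

/-- The context-free tree grammar of a pushdown tree system. -/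
def toCFTG : CFTG T where
  nonterminals := stackAlphabet Q
  axiomTree := ofStack [P.start]
  productions := {p | P.IsProduction p}
  finite_productions := by
    have := T.finite_sym
    refine ((Set.finite_range fun q : Q => production (T := T) q (.var 0)).union <|
      (Set.finite_range fun x : Q × Q => production (T := T) x.1 (cons x.2 (.var 0))).union <|
      (Set.finite_range fun x : Q × Q × Q =>
        production (T := T) x.1 (cons x.2.1 (cons x.2.2 (.var 0)))).union <|
      Set.finite_range fun x : Q × (s : T.Sym) × Option (Fin (T.rank s)) × (Fin (T.rank s) → Q) =>
        production x.1 (readTree x.2.1 x.2.2.1 x.2.2.2)).subset ?_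
    rintro p (⟨h⟩ | ⟨h⟩ | ⟨h⟩ | ⟨h⟩)
    · exact .inl ⟨_, rfl⟩
    · exact .inr (.inl ⟨(_, _), rfl⟩)
    · exact .inr (.inr (.inl ⟨(_, _, _), rfl⟩))
    · exact .inr (.inr (.inr ⟨(_, ⟨_, _, _⟩), rfl⟩))

theorem count_bottom {U : Type*} [DecidableEq U] (x : U) :
    (bottom (T := T) (Q := Q) : RTree _ U).count x = 0 :=
  Finset.sum_eq_zero fun i _ => Fin.elim0 i

theorem count_cons {U : Type*} [DecidableEq U] (x : U) (q : Q)
    (ξ : RTree ((stackAlphabet Q).disjSum T) U) : (cons q ξ).count x = ξ.count x :=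
  (Fin.sum_univ_one _).trans rfl

theorem count_var_le {T : RankedAlphabet.{v}} {U : Type*} [DecidableEq U] (x y : U) :
    (RTree.var (T := T) y).count x ≤ 1 := by
  simp only [RTree.count]
  split_ifs <;> simp

theorem count_readTree_le (s : T.Sym) (i : Option (Fin (T.rank s))) (qs : Fin (T.rank s) → Q)
    (x : Fin 1) : (readTree s i qs).count x ≤ 1 := by
  refine (Finset.sum_le_sum (g := fun j : Fin (T.rank s) => if i = some j then 1 else 0)
    fun (j : Fin (T.rank s)) _ => ?_).trans ?_
  · rw [count_cons]
    split_ifs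
    · exact count_var_le x 0
    · exact (count_bottom x).le
  · change ∑ j : Fin (T.rank s), (if i = some j then 1 else 0) ≤ 1
    cases i with
    | none => simp
    | some i => simp

theorem isLinear_toCFTG : P.toCFTG.IsLinear := by
  intro p hp x
  change P.IsProduction p at hp
  cases hp with
  | pop h => exact count_var_le (U := Fin 1) x 0
  | move h => exact (count_cons (U := Fin 1) x _ _).trans_le (count_var_le (U := Fin 1) x 0)
  | push h =>
    exact ((count_cons (U := Fin 1) x _ _).trans (count_cons (U := Fin 1) x _ _)).trans_le
      (count_var_le (U := Fin 1) x 0)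
  | read h => exact count_readTree_le _ _ _ x

theorem isMonadic_toCFTG : P.toCFTG.IsMonadic := by
  rintro (_ | q)
  · exact Nat.zero_le 1
  · exact le_refl 1

theorem subst_bottom {U V : Type*} (f : U → RTree ((stackAlphabet Q).disjSum T) V) :
    bottom.subst f = bottom := by
  simp only [bottom, RTree.subst]
  congr 1
  funext i
  exact Fin.elim0 i

theorem subst_cons {U V : Type*} (f : U → RTree ((stackAlphabet Q).disjSum T) V) (q : Q)
    (ξ : RTree ((stackAlphabet Q).disjSum T) U) : (cons q ξ).subst f = cons q (ξ.subst f) := rfl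

theorem subst_readTree {U : Type*} (s : T.Sym) (i : Option (Fin (T.rank s)))
    (qs : Fin (T.rank s) → Q) (l : List Q)
    (f : Fin 1 → RTree ((stackAlphabet Q).disjSum T) U) (hf : f 0 = ofStack l) :
    (readTree s i qs).subst f = .node (T := (stackAlphabet Q).disjSum T) (Sum.inr s) fun j : Fin (T.rank s) =>
      ofStack (qs j :: if i = some j then l else []) := by
  simp only [readTree, RTree.subst]
  congr 1
  funext j
  rw [subst_cons, ofStack]
  split_ifs
  · rw [RTree.subst, hf]
  · rw [subst_bottom, ofStack]

theorem gen_cons {U : Type*} {P : PushdownTreeSystem T Q} {q : Q}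
    {ξ : RTree ((stackAlphabet Q).disjSum T) (Fin 1)} {η : RTree ((stackAlphabet Q).disjSum T) U}
    {t : GroundTree T} (hp : P.IsProduction (production q ξ))
    (h : P.toCFTG.Gen (ξ.subst fun _ => η) t) : P.toCFTG.Gen (cons q η) t :=
  CFTG.Gen.nonterminal (G := P.toCFTG) (production q ξ) hp (fun _ => η) t h

theorem Gen.toCFTG {U : Type*} {P : PushdownTreeSystem T Q} {l : List Q} {t : GroundTree T}
    (h : P.Gen l t) : P.toCFTG.Gen (U := U) (ofStack l) t := by
  induction h with
  | pop hq h ih => exact gen_cons (.pop hq) ih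
  | move hq h ih => exact gen_cons (.move hq) ih
  | push hq h ih => exact gen_cons (.push hq) ih
  | @read q s i qs l ts hq h ih =>
    have hsub := subst_readTree s i qs l (fun _ => ofStack (U := U) l) rfl
    exact gen_cons (.read hq) (hsub ▸ .terminal (G := P.toCFTG) s _ ts ih)

theorem ofStack_eq_node {U : Type*} {l : List Q} {p : CFTProduction (stackAlphabet Q) T}
    {q : Q} (hp : p.lhs = some q)
    {τ : Fin ((stackAlphabet Q).rank p.lhs) → RTree ((stackAlphabet Q).disjSum T) U}
    (h : ofStack l = RTree.node (T := (stackAlphabet Q).disjSum T) (Sum.inl p.lhs) τ) :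
    ∃ l', l = q :: l' ∧ ∀ k, τ k = ofStack l' := by
  obtain ⟨A, ξ⟩ := p
  cases hp
  cases l with
  | nil => cases h
  | cons q' l' =>
    cases h
    exact ⟨l', rfl, fun _ => rfl⟩

/-- The second conjunct keeps the induction going through a read: its production yields a terminal
root above stacks, which is not itself a stack. -/
theorem gen_of_toCFTG {U : Type*} {P : PushdownTreeSystem T Q}
    {ξ : RTree (P.toCFTG.nonterminals.disjSum T) U} {t : GroundTree T} (h : P.toCFTG.Gen ξ t) :
    (∀ l, ofStack l = ξ → P.Gen l t) ∧
    ∀ (s : T.Sym) (f : Fin (T.rank s) → List Q),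
      ξ = .node (T := (stackAlphabet Q).disjSum T) (Sum.inr s) (fun j => ofStack (f j)) →
      ∃ ts, t = .node s ts ∧ ∀ j, P.Gen (f j) (ts j) := by
  induction h with
  | terminal s ξ ts h ih =>
    constructor
    · intro l hl
      cases l <;> cases hl
    · intro s' f hf
      cases hf
      exact ⟨ts, rfl, fun j => (ih j).1 _ rfl⟩
  | nonterminal p hp τ t h ih =>
    refine ⟨fun l hl => ?_, fun s' f hf => by cases hf⟩
    change P.IsProduction p at hp
    cases hp with
    | pop hq =>
      obtain ⟨l', rfl, hτ⟩ := ofStack_eq_node rfl hl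
      exact .pop hq (ih.1 l' (hτ (0 : Fin 1)).symm)
    | move hq =>
      obtain ⟨l', rfl, hτ⟩ := ofStack_eq_node rfl hl
      exact .move hq (ih.1 _ (congrArg (cons _) (hτ (0 : Fin 1)).symm))
    | push hq =>
      obtain ⟨l', rfl, hτ⟩ := ofStack_eq_node rfl hl
      exact .push hq (ih.1 _ (congrArg (fun ξ => cons _ (cons _ ξ)) (hτ (0 : Fin 1)).symm))
    | @read q s i qs hq =>
      obtain ⟨l', rfl, hτ⟩ := ofStack_eq_node rfl hl
      obtain ⟨ts, rfl, hts⟩ := ih.2 s _ (subst_readTree s i qs l' τ (hτ (0 : Fin 1)))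
      exact .read hq hts

theorem language_toCFTG : P.toCFTG.language = P.language := by
  ext t
  rw [CFTG.mem_language_iff]
  exact ⟨fun h => (gen_of_toCFTG h).1 _ rfl, fun h => h.toCFTG⟩

end Grammar

theorem isLinearMonadicCFTL [Finite Q] (P : PushdownTreeSystem T Q) :
    IsLinearMonadicCFTL P.language := by
  -- Nonterminals live in `Type`, so the states are first renamed to `Fin n`.
  obtain ⟨n, ⟨e⟩⟩ := Finite.exists_equiv_fin Q
  exact ⟨(P.congr e).toCFTG, isLinear_toCFTG _, isMonadic_toCFTG _, by
    rw [language_toCFTG, language_congr]⟩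

end PushdownTreeSystem

/-! ### From linear monadic grammars to pushdown tree systems -/

namespace RTree

/-- The set of all subtrees. -/
def subtrees {T : RankedAlphabet.{u}} {U : Type w} : RTree T U → Set (RTree T U)
  | var x => {var x}
  | node s ts => {node s ts} ∪ ⋃ i, subtrees (ts i)

variable {T : RankedAlphabet.{u}} {U : Type w}

theorem self_mem_subtrees (t : RTree T U) : t ∈ t.subtrees := by
  cases t <;> simp [subtrees]

theorem finite_subtrees (t : RTree T U) : t.subtrees.Finite := by
  induction t with
  | var x => exact Set.finite_singleton _
  | node s ts ih => exact (Set.finite_singleton _).union (Set.finite_iUnion ih)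

theorem child_mem_subtrees {t : RTree T U} {s : T.Sym} {ts : Fin (T.rank s) → RTree T U}
    (h : node s ts ∈ t.subtrees) (i : Fin (T.rank s)) : ts i ∈ t.subtrees := by
  induction t with
  | var x => simp [subtrees] at h
  | node s' ts' ih =>
    rcases h with h | h
    · cases h
      exact .inr (Set.mem_iUnion.2 ⟨i, self_mem_subtrees _⟩)
    · obtain ⟨j, hj⟩ := Set.mem_iUnion.1 h
      exact .inr (Set.mem_iUnion.2 ⟨j, ih j hj⟩)

theorem IsLinear.of_mem_subtrees [DecidableEq U] {t e : RTree T U} (h : t.IsLinear)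
    (he : e ∈ t.subtrees) : e.IsLinear := by
  induction t with
  | var x => cases he; exact h
  | node s ts ih =>
    rcases he with he | he
    · cases he; exact h
    · obtain ⟨j, hj⟩ := Set.mem_iUnion.1 he
      exact ih j (h.child j) hj

theorem count_subst_const {n : ℕ} (t : RTree T (Fin n)) :
    (t.subst fun _ => var (0 : Fin 1)).count 0 = ∑ x, t.count x := by
  induction t with
  | var y => simp [subst, count]
  | node s ts ih =>
    simp only [subst, count, ih]
    exact Finset.sum_comm

theorem IsLinear.subst_const {n : ℕ} (hn : n ≤ 1) {t : RTree T (Fin n)} (h : t.IsLinear) :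
    (t.subst fun _ => var (0 : Fin 1)).IsLinear := by
  intro x
  rw [Subsingleton.elim x 0, count_subst_const]
  refine (Finset.sum_le_sum fun x _ => h x).trans ?_
  simpa using hn

end RTree

namespace CFTG

variable {T : RankedAlphabet.{v}} (G : CFTG T)

/-- The trees over nonterminals and terminals that serve as states of the pushdown tree system
of a grammar; the variable stands for the stack below the state. -/
def items : Set (RTree (G.nonterminals.disjSum T) (Fin 1)) :=
  (G.axiomTree.subst fun _ => .var 0).subtrees ∪
    ⋃ p ∈ G.productions, (p.rhs.subst fun _ => .var 0).subtrees

theorem finite_items : G.items.Finite :=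
  (RTree.finite_subtrees _).union (G.finite_productions.biUnion fun _ _ => RTree.finite_subtrees _)

variable {G}

theorem child_mem_items {s : (G.nonterminals.disjSum T).Sym}
    {ts : Fin ((G.nonterminals.disjSum T).rank s) → RTree (G.nonterminals.disjSum T) (Fin 1)}
    (h : RTree.node s ts ∈ G.items) (i : Fin ((G.nonterminals.disjSum T).rank s)) :
    ts i ∈ G.items := by
  rcases h with h | h
  · exact .inl (RTree.child_mem_subtrees h i)
  · obtain ⟨p, hp, h⟩ := Set.mem_iUnion₂.1 h
    exact .inr (Set.mem_iUnion₂.2 ⟨p, hp, RTree.child_mem_subtrees h i⟩)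

theorem rhs_mem_items {p : CFTProduction G.nonterminals T} (hp : p ∈ G.productions) :
    (p.rhs.subst fun _ => .var 0) ∈ G.items :=
  .inr (Set.mem_iUnion₂.2 ⟨p, hp, RTree.self_mem_subtrees _⟩)

theorem isLinear_of_mem_items (hlin : G.IsLinear) (hmon : G.IsMonadic)
    {e : RTree (G.nonterminals.disjSum T) (Fin 1)} (he : e ∈ G.items) : e.IsLinear := by
  rcases he with h | h
  · exact RTree.IsLinear.of_mem_subtrees (.subst_const zero_le_one fun x => x.elim0) h
  · obtain ⟨p, hp, h⟩ := Set.mem_iUnion₂.1 h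
    exact RTree.IsLinear.of_mem_subtrees (.subst_const (hmon _) (hlin p hp)) h

variable (G)

/-- The pushdown tree system of a linear monadic context-free tree grammar. -/
def toPushdown : PushdownTreeSystem T G.items where
  start := ⟨G.axiomTree.subst fun _ => .var 0, .inl (RTree.self_mem_subtrees _)⟩
  pop e := e.1 = .var 0
  -- A nullary nonterminal has no argument to push. Its right-hand side has no variable, so
  -- `flatten` ignores the stack below.
  move e a := ∃ p ∈ G.productions, ∃ τ,
    e.1 = .node (T := G.nonterminals.disjSum T) (Sum.inl p.lhs) τ ∧
    a.1 = (p.rhs.subst fun _ => .var 0) ∧ IsEmpty (Fin (G.nonterminals.rank p.lhs))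
  push e a b := ∃ p ∈ G.productions, ∃ τ,
    e.1 = .node (T := G.nonterminals.disjSum T) (Sum.inl p.lhs) τ ∧
    a.1 = (p.rhs.subst fun _ => .var 0) ∧ ∃ k : Fin (G.nonterminals.rank p.lhs), b.1 = τ k
  read e s i qs := ∃ τ : Fin (T.rank s) → _,
    e.1 = .node (T := G.nonterminals.disjSum T) (Sum.inr s) τ ∧
    -- The stack must go to a child containing the variable; without such a child, `i` is arbitrary.
    ∀ j, (qs j).1 = τ j ∧ ((τ j).count 0 ≠ 0 → i = some j)

variable {G}

/-- The tree represented by a stack of items. -/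
def flatten : List G.items → RTree (G.nonterminals.disjSum T) (Fin 1)
  | [] => .var 0
  | e :: l => e.1.subst fun _ => flatten l

theorem gen_flatten (hmon : G.IsMonadic) {l : List G.items} {t : GroundTree T}
    (h : G.toPushdown.Gen l t) : G.Gen (flatten l) t := by
  induction h with
  | @pop q l t hq h ih =>
    obtain ⟨e, he⟩ := q
    cases hq
    exact ih
  | @move q a l t hq h ih =>
    obtain ⟨p, hp, τ, h1, h2, h3⟩ := hq
    rw [flatten, h1]
    refine .nonterminal p hp _ t ?_
    rw [flatten, h2, RTree.subst_subst] at ih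
    convert ih using 1
    refine congrArg (RTree.subst · p.rhs)
      (funext fun x : Fin (G.nonterminals.rank p.lhs) => ?_)
    exact h3.elim x
  | @push q a b l t hq h ih =>
    obtain ⟨p, hp, τ, h1, h2, k, h3⟩ := hq
    rw [flatten, h1]
    refine .nonterminal p hp _ t ?_
    rw [flatten, h2, RTree.subst_subst, flatten, h3] at ih
    convert ih using 1
    refine congrArg (RTree.subst · p.rhs)
      (funext fun x : Fin (G.nonterminals.rank p.lhs) => ?_)
    have hx : x = k := by
      have := hmon p.lhs
      ext
      omega
    rw [hx]
    rfl
  | @read q s i qs l ts hq h ih =>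
    obtain ⟨τ, h1, h2⟩ := hq
    rw [flatten, h1]
    refine .terminal s _ ts fun j => ?_
    have := ih j
    rw [flatten, (h2 j).1] at this
    convert this using 1
    refine RTree.subst_congr_of_count fun x hx => ?_
    rw [Subsingleton.elim x 0] at hx
    rw [if_pos ((h2 j).2 hx)]

/-- The inner induction on the stack pops items that are just the variable, which leaves `flatten`
unchanged, until the root of the flattened tree is the root of the top item. -/
theorem gen_toPushdown (hlin : G.IsLinear) (hmon : G.IsMonadic)
    {ξ : RTree (G.nonterminals.disjSum T) (Fin 1)} {t : GroundTree T} (h : G.Gen ξ t) :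
    ∀ l, flatten l = ξ → G.toPushdown.Gen l t := by
  classical
  induction h with
  | terminal s ξ ts h ih =>
    intro l
    induction l with
    | nil => intro hl; cases hl
    | cons q l ihl =>
      obtain ⟨e, he⟩ := q
      intro hl
      cases e with
      | var x =>
        refine .pop (congrArg RTree.var (Subsingleton.elim x 0)) (ihl hl)
      | node s' τ =>
        cases hl
        let i : Option (Fin (T.rank s)) :=
          if h : ∃ j : Fin (T.rank s), (τ j).count 0 ≠ 0 then some h.choose else none
        have hi : ∀ j : Fin (T.rank s), (τ j).count 0 ≠ 0 → i = some j := by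
          intro j hj
          have hex : ∃ j : Fin (T.rank s), (τ j).count 0 ≠ 0 := ⟨j, hj⟩
          simp only [i, dif_pos hex, Option.some.injEq]
          exact (isLinear_of_mem_items hlin hmon he).child_unique hex.choose_spec hj
        refine .read (i := i) (qs := fun j : Fin (T.rank s) => ⟨τ j, child_mem_items he j⟩)
          ⟨τ, rfl, fun j => ⟨rfl, hi j⟩⟩ fun j => ih j _ ?_
        refine RTree.subst_congr_of_count fun x hx => ?_
        rw [Subsingleton.elim x 0] at hx
        rw [if_pos (hi j hx)]
  | nonterminal p hp τ t h ih =>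
    intro l
    induction l with
    | nil => intro hl; cases hl
    | cons q l ihl =>
      obtain ⟨e, he⟩ := q
      intro hl
      cases e with
      | var x =>
        refine .pop (congrArg RTree.var (Subsingleton.elim x 0)) (ihl hl)
      | node s' τ' =>
        cases hl
        rcases isEmpty_or_nonempty (Fin (G.nonterminals.rank p.lhs)) with hr | ⟨⟨k⟩⟩
        · refine .move (a := ⟨_, rhs_mem_items hp⟩) ⟨p, hp, τ', rfl, rfl, hr⟩ (ih _ ?_)
          rw [flatten, RTree.subst_subst]
          congr 1
          funext x
          exact hr.elim x
        · refine .push (a := ⟨_, rhs_mem_items hp⟩) (b := ⟨τ' k, child_mem_items he k⟩)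
            ⟨p, hp, τ', rfl, rfl, k, rfl⟩ (ih _ ?_)
          rw [flatten, RTree.subst_subst]
          congr 1
          funext x
          have hx : x = k := by
            have := hmon p.lhs
            ext
            omega
          rw [hx]
          rfl

theorem language_toPushdown (hlin : G.IsLinear) (hmon : G.IsMonadic) :
    G.toPushdown.language = G.language := by
  ext t
  rw [mem_language_iff]
  have hself : flatten [G.toPushdown.start] = G.axiomTree.subst fun _ => .var 0 :=
    RTree.subst_subst _ _ _
  constructor
  · intro h
    -- Any ground tree could replace the variable, which does not occur in the axiom.
    have h' := (hself ▸ gen_flatten hmon h).subst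
      fun _ => G.axiomTree
    rwa [RTree.subst_subst, show (fun x : Fin 0 => _) = RTree.var from
      funext fun x : Fin 0 => x.elim0, RTree.subst_var] at h'
  · exact fun h => gen_toPushdown hlin hmon (h.subst _) _ hself

end CFTG

/-- Linear monadic context-free tree grammars and pushdown tree systems are equivalent. -/
theorem isLinearMonadicCFTL_iff {T : RankedAlphabet.{v}} {L : Set (GroundTree T)} :
    IsLinearMonadicCFTL L ↔
      ∃ (Q : Type v) (_ : Finite Q) (P : PushdownTreeSystem T Q), P.language = L := by
  constructor
  · rintro ⟨G, hlin, hmon, rfl⟩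
    exact ⟨_, G.finite_items, G.toPushdown, CFTG.language_toPushdown hlin hmon⟩
  · rintro ⟨Q, _, P, rfl⟩
    exact P.isLinearMonadicCFTL

/-! ### Runs on a tree with variables -/

namespace RTree

def height {T : RankedAlphabet.{u}} {U : Type w} : RTree T U → ℕ
  | var _ => 0
  | node _ ts => (Finset.univ.sup fun i => height (ts i)) + 1

theorem height_child_lt {T : RankedAlphabet.{u}} {U : Type w} {s : T.Sym}
    (ts : Fin (T.rank s) → RTree T U) (i : Fin (T.rank s)) :
    (ts i).height < (node s ts).height :=
  Nat.lt_succ_of_le (Finset.le_sup (f := fun i => (ts i).height) (Finset.mem_univ i))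

end RTree

namespace PushdownTreeSystem

variable {D : RankedAlphabet.{v}} {Q : Type w}

/-- `P.Exec l p l'`: the stack `l` can be turned into `l'` by a run whose reading transitions
change the top state and keep the rest of the stack, and are recorded in the word `p`. -/
inductive Exec (P : PushdownTreeSystem D Q) : List Q → List (Q × Q) → List Q → Prop
  | refl (l) : Exec P l [] l
  | pop {q l p l'} (hq : P.pop q) (h : Exec P l p l') : Exec P (q :: l) p l'
  | move {q a l p l'} (hq : P.move q a) (h : Exec P (a :: l) p l') : Exec P (q :: l) p l'
  | push {q a b l p l'} (hq : P.push q a b) (h : Exec P (a :: b :: l) p l') :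
      Exec P (q :: l) p l'
  -- Any pair `(q, a)` is allowed; `Reads` checks that it comes from a transition.
  | step {q a l p l'} (h : Exec P (a :: l) p l') : Exec P (q :: l) ((q, a) :: p) l'

variable {P : PushdownTreeSystem D Q}

theorem Exec.gen {l p l' t} (h : P.Exec l p l') (hp : p = []) (ht : P.Gen l' t) : P.Gen l t := by
  induction h with
  | refl l => exact ht
  | pop hq h ih => exact .pop hq (ih hp ht)
  | move hq h ih => exact .move hq (ih hp ht)
  | push hq h ih => exact .push hq (ih hp ht)
  | step h ih => cases hp

/-- Cuts a run at its first recorded read; `m` is the part of the stack which that read hands on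
untouched. -/
theorem Exec.exists_of_cons {l p l' q a} (h : P.Exec l ((q, a) :: p) l') :
    ∃ m, P.Exec l [] (q :: m) ∧ P.Exec (a :: m) p l' := by
  generalize hw : (q, a) :: p = w at h
  induction h with
  | refl l => cases hw
  | pop hq h ih => obtain ⟨m, h1, h2⟩ := ih hw; exact ⟨m, .pop hq h1, h2⟩
  | move hq h ih => obtain ⟨m, h1, h2⟩ := ih hw; exact ⟨m, .move hq h1, h2⟩
  | push hq h ih => obtain ⟨m, h1, h2⟩ := ih hw; exact ⟨m, .push hq h1, h2⟩
  | step h ih => cases hw; exact ⟨_, .refl _, h⟩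

/-- Words of length at most `N`. -/
abbrev Word (Q : Type w) (N : ℕ) : Type w := {p : List (Q × Q) // p.length ≤ N}

/-- A subtree below a variable is either unconstrained, or has to be generated by a state
after the execution of a word. -/
abbrev Demand (Q : Type w) (N : ℕ) : Type w := Option (Word Q N × Q)

variable {N k : ℕ}

def Demand.Holds (P : PushdownTreeSystem D Q) : Demand Q N → GroundTree D → Prop
  | none, _ => True
  | some (p, q), t => ∃ l, P.Exec [q] p.1 l ∧ P.Gen l t

/-- A run that starts with the stack `[q]` and executes `p`, and then reaches a variable
or discards the stack, respects the demands `ξ`. -/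
def Meets (P : PushdownTreeSystem D Q) (ξ : Fin k → Demand Q N) (q : Q) (p : List (Q × Q)) :
    Fin k ⊕ Q → Prop
  | .inl i => ∃ w : Word Q N, ξ i = some (w, q) ∧ w.1 = p
  | .inr a => ∃ l, P.Exec [q] p (a :: l)

/-- `P.Reads ξ s p e`: a run on the tree `s` executes the word `p` on the way from the root of `s`
to its end `e`, where it reaches a variable or discards the stack in some state, provided that the
subtrees that are substituted for the other variables fulfil the demands `ξ`. -/
inductive Reads (P : PushdownTreeSystem D Q) (ξ : Fin k → Demand Q N) :
    RTree D (Fin k) → List (Q × Q) → Fin k ⊕ Q → Prop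
  | var (i : Fin k) : Reads P ξ (.var i) [] (.inl i)
  | inherit {q s i qs} {ts : Fin (D.rank s) → RTree D (Fin k)} (p : Fin (D.rank s) → List (Q × Q))
      (e : Fin (D.rank s) → Fin k ⊕ Q) (hq : P.read q s (some i) qs)
      (h : ∀ j, Reads P ξ (ts j) (p j) (e j)) (hm : ∀ j, j ≠ i → P.Meets ξ (qs j) (p j) (e j)) :
      Reads P ξ (.node s ts) ((q, qs i) :: p i) (e i)
  | discard {q s qs} {ts : Fin (D.rank s) → RTree D (Fin k)} (p : Fin (D.rank s) → List (Q × Q))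
      (e : Fin (D.rank s) → Fin k ⊕ Q) (hq : P.read q s none qs)
      (h : ∀ j, Reads P ξ (ts j) (p j) (e j)) (hm : ∀ j, P.Meets ξ (qs j) (p j) (e j)) :
      Reads P ξ (.node s ts) [] (.inr q)

/-- One letter is recorded per level of the path. This bound lets words be restricted to a finite
set. -/
theorem Reads.length_le {ξ : Fin k → Demand Q N} {s p e} (h : P.Reads ξ s p e) :
    p.length ≤ s.height := by
  induction h with
  | var i => simp
  | @inherit q s i qs ts p e hq h hm ih =>
    exact Nat.succ_le_of_lt ((ih i).trans_lt (RTree.height_child_lt ts i))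
  | discard => simp

theorem Reads.count_ne_zero {ξ : Fin k → Demand Q N} {s p e i} (h : P.Reads ξ s p e)
    (he : e = .inl i) : s.count i ≠ 0 := by
  induction h with
  | var j => cases he; simp [RTree.count]
  | @inherit q s j qs ts p e hq h hm ih =>
    have := RTree.count_le_node ts i j
    have := ih j he
    omega
  | discard => cases he

theorem Meets.congr {ξ ξ' : Fin k → Demand Q N} {q p e}
    (hξ : ∀ i, e = .inl i → ξ i = ξ' i) (h : P.Meets ξ q p e) : P.Meets ξ' q p e := by
  cases e with
  | inl i => rwa [Meets, ← hξ i rfl]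
  | inr a => exact h

/-- Only demands on occurring variables matter, so families found separately for the subtrees can be
glued by `exists_demand`. -/
theorem Reads.congr {ξ ξ' : Fin k → Demand Q N} {s p e} (h : P.Reads ξ s p e)
    (hξ : ∀ i, s.count i ≠ 0 → ξ i = ξ' i) : P.Reads ξ' s p e := by
  induction h with
  | var i => exact .var i
  | @inherit q s i qs ts p e hq h hm ih =>
    have hξ' : ∀ j x, (ts j).count x ≠ 0 → ξ x = ξ' x := fun j x hx =>
      hξ x fun h0 => hx (Nat.eq_zero_of_le_zero (h0 ▸ RTree.count_le_node ts x j))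
    exact .inherit p e hq (fun j => ih j (hξ' j)) fun j hj =>
      (hm j hj).congr fun x hx => hξ' j x ((h j).count_ne_zero hx)
  | @discard q s qs ts p e hq h hm ih =>
    have hξ' : ∀ j x, (ts j).count x ≠ 0 → ξ x = ξ' x := fun j x hx =>
      hξ x fun h0 => hx (Nat.eq_zero_of_le_zero (h0 ▸ RTree.count_le_node ts x j))
    exact .discard p e hq (fun j => ih j (hξ' j)) fun j =>
      (hm j).congr fun x hx => hξ' j x ((h j).count_ne_zero hx)

/-- What remains to be done at the end of a run on a tree. -/
def Finishes (P : PushdownTreeSystem D Q) (f : Fin k → GroundTree D) (l : List Q) :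
    Fin k ⊕ Q → Prop
  | .inl i => P.Gen l (f i)
  | .inr a => ∃ l', l = a :: l'

theorem Reads.gen {ξ : Fin k → Demand Q N} {f : Fin k → GroundTree D} {s p e}
    (h : P.Reads ξ s p e) (hξ : ∀ i, (ξ i).Holds P (f i)) {l l'} (hl : P.Exec l p l')
    (hf : P.Finishes f l' e) : P.Gen l (s.subst f) := by
  -- Side branches: `Meets` and the demand at the end supply the execution that the induction
  -- hypothesis asks for.
  have meets : ∀ {t : RTree D (Fin k)} {q p e},
      (∀ {l l'}, P.Exec l p l' → P.Finishes f l' e → P.Gen l (t.subst f)) →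
      P.Meets ξ q p e → P.Gen [q] (t.subst f) := by
    intro t q p e ih hm
    cases e with
    | inl i =>
      obtain ⟨w, hw, rfl⟩ := hm
      have := hξ i
      rw [hw] at this
      obtain ⟨l, h1, h2⟩ := this
      exact ih h1 h2
    | inr a =>
      obtain ⟨l, hl⟩ := hm
      exact ih hl ⟨l, rfl⟩
  induction h generalizing l l' with
  | var i => exact hl.gen rfl hf
  | @inherit q s i qs ts p e hq h hm ih =>
    obtain ⟨m, h1, h2⟩ := hl.exists_of_cons
    refine h1.gen rfl (.read hq fun j => ?_)
    by_cases hj : j = i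
    · subst hj
      rw [if_pos rfl]
      exact ih j h2 hf
    · rw [if_neg (by simpa using Ne.symm hj)]
      exact meets (ih j) (hm j hj)
  | @discard q s qs ts p e hq h hm ih =>
    obtain ⟨m, rfl⟩ := hf
    refine hl.gen rfl (.read hq fun j => ?_)
    exact meets (ih j) (hm j)

/-- Demands on the variables of the direct subtrees of a linear tree can be combined. -/
theorem exists_demand {s : D.Sym} {ts : Fin (D.rank s) → RTree D (Fin k)}
    (hlin : (RTree.node s ts).IsLinear) (f : Fin k → GroundTree D)
    (ξ : Fin (D.rank s) → Fin k → Demand Q N) (hξ : ∀ j i, (ξ j i).Holds P (f i)) :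
    ∃ ζ : Fin k → Demand Q N, (∀ i, (ζ i).Holds P (f i)) ∧
      ∀ j i, (ts j).count i ≠ 0 → ξ j i = ζ i := by
  classical
  -- A variable occurring in no subtree is left unconstrained.
  refine ⟨fun i => if h : ∃ j, (ts j).count i ≠ 0 then ξ h.choose i else none,
    fun i => ?_, fun j i hj => ?_⟩
  · dsimp only
    split_ifs with h
    · exact hξ _ i
    · trivial
  · have h : ∃ j, (ts j).count i ≠ 0 := ⟨j, hj⟩
    simp only [dif_pos h]
    rw [hlin.child_unique h.choose_spec hj]

/-- The converse of `Reads.gen`. The demand `z` at the end variable stays open because it depends on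
the surroundings: a side branch sets it to its own word and start state, an inheriting branch passes
it upwards, and at the root of `h s` it becomes `none`. -/
theorem exists_reads {f : Fin k → GroundTree D} {l t} (h : P.Gen l t) :
    ∀ {s : RTree D (Fin k)}, s.IsLinear → s.height ≤ N → s.subst f = t →
    ∃ p e l', P.Exec l p l' ∧ P.Finishes f l' e ∧
      ∀ z : Demand Q N, (∀ i, e = .inl i → z.Holds P (f i)) →
        ∃ ξ : Fin k → Demand Q N, P.Reads ξ s p e ∧ (∀ i, e = .inl i → ξ i = z) ∧
          ∀ i, (ξ i).Holds P (f i) := by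
  have var : ∀ {l t}, P.Gen l t → ∀ i : Fin k, (RTree.var i : RTree D (Fin k)).subst f = t →
    ∃ p e l', P.Exec l p l' ∧ P.Finishes f l' e ∧
      ∀ z : Demand Q N, (∀ i, e = .inl i → z.Holds P (f i)) →
        ∃ ξ : Fin k → Demand Q N, P.Reads ξ (.var i) p e ∧ (∀ i, e = .inl i → ξ i = z) ∧
          ∀ i, (ξ i).Holds P (f i) := by
    rintro l t h i rfl
    refine ⟨[], .inl i, l, .refl l, h, fun z hz =>
      ⟨Function.update (fun _ => none) i z, .var i, ?_, fun j => ?_⟩⟩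
    · rintro j hj
      cases hj
      exact Function.update_self ..
    · by_cases hj : j = i
      · subst hj
        rw [Function.update_self]
        exact hz j rfl
      · rw [Function.update_of_ne hj]
        trivial
  induction h with
  | pop hq h ih =>
    intro s h1 h2 h3
    obtain ⟨p, e, l', h4, h5⟩ := ih h1 h2 h3
    exact ⟨p, e, l', .pop hq h4, h5⟩
  | move hq h ih =>
    intro s h1 h2 h3
    obtain ⟨p, e, l', h4, h5⟩ := ih h1 h2 h3
    exact ⟨p, e, l', .move hq h4, h5⟩
  | push hq h ih =>
    intro s h1 h2 h3
    obtain ⟨p, e, l', h4, h5⟩ := ih h1 h2 h3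
    exact ⟨p, e, l', .push hq h4, h5⟩
  | @read q s i qs l us hq h ih =>
    rintro (x | ⟨s', ts⟩) hlin hN hs
    · exact var (.read hq h) x hs
    · cases hs
      choose p e m hexec hfin hex using fun j =>
        ih j (hlin.child j) ((RTree.height_child_lt ts j).le.trans hN) rfl
      have side : ∀ j, i ≠ some j → ∃ ξ : Fin k → Demand Q N, P.Reads ξ (ts j) (p j) (e j) ∧
          P.Meets ξ (qs j) (p j) (e j) ∧ ∀ i, (ξ i).Holds P (f i) := by
        intro j hj
        have hexec' := hexec j
        have hfin' := hfin j
        rw [if_neg hj] at hexec'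
        cases he : e j with
        | inl x =>
          -- This first use, with a dummy demand, only yields the length bound needed to state the
          -- true demand.
          obtain ⟨ξ, h1, h2, h3⟩ := hex j none fun _ _ => trivial
          rw [he] at hfin'
          have hlen : (p j).length ≤ N :=
            h1.length_le.trans ((RTree.height_child_lt ts j).le.trans hN)
          obtain ⟨ξ, h1, h2, h3⟩ := hex j (some (⟨p j, hlen⟩, qs j)) (by
            intro y hy
            cases he.symm.trans hy
            exact ⟨m j, hexec', hfin'⟩)
          exact ⟨ξ, he ▸ h1, ⟨⟨p j, hlen⟩, h2 x he, rfl⟩, h3⟩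
        | inr a =>
          obtain ⟨ξ, h1, -, h3⟩ := hex j none fun _ _ => trivial
          rw [he] at hfin'
          obtain ⟨l', hl'⟩ := hfin'
          exact ⟨ξ, he ▸ h1, ⟨l', hl' ▸ hexec'⟩, h3⟩
      cases i with
      | none =>
        choose ξ h1 h2 h3 using fun j => side j (by simp)
        obtain ⟨ζ, h4, h5⟩ := exists_demand hlin f ξ h3
        refine ⟨[], .inr q, q :: l, .refl _, ⟨l, rfl⟩, fun z _ => ⟨ζ, ?_, nofun, h4⟩⟩
        exact .discard p e hq (fun j => (h1 j).congr (h5 j)) fun j =>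
          (h2 j).congr fun x hx => h5 j x ((h1 j).count_ne_zero hx)
      | some i =>
        have hexec' := hexec i
        rw [if_pos rfl] at hexec'
        refine ⟨_, e i, m i, .step hexec', hfin i, fun z hz => ?_⟩
        have : ∀ j, ∃ ξ : Fin k → Demand Q N, P.Reads ξ (ts j) (p j) (e j) ∧
            (j ≠ i → P.Meets ξ (qs j) (p j) (e j)) ∧
            (j = i → ∀ x, e i = .inl x → ξ x = z) ∧ ∀ i, (ξ i).Holds P (f i) := by
          intro j
          by_cases hj : j = i
          · subst hj
            obtain ⟨ξ, h1, h2, h3⟩ := hex j z hz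
            exact ⟨ξ, h1, fun h => absurd rfl h, fun _ => h2, h3⟩
          · obtain ⟨ξ, h1, h2, h3⟩ := side j (by simpa using Ne.symm hj)
            exact ⟨ξ, h1, fun _ => h2, fun h => absurd h hj, h3⟩
        choose ξ h1 h2 h3 h4 using this
        obtain ⟨ζ, h5, h6⟩ := exists_demand hlin f ξ h4
        refine ⟨ζ, ?_, fun x hx => ?_, h5⟩
        · exact .inherit p e hq (fun j => (h1 j).congr (h6 j)) fun j hj =>
            (h2 j hj).congr fun x hx => h6 j x ((h1 j).count_ne_zero hx)
        · rw [← h6 i x ((h1 i).count_ne_zero hx), h3 i rfl x hx]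

end PushdownTreeSystem

/-! ### The pushdown tree system of the inverse image -/

namespace PushdownTreeSystem

variable {S : RankedAlphabet.{u}} {D : RankedAlphabet.{v}} {Q : Type w} {N : ℕ}

/-- The announcement that, after the execution of a word, the stack is discarded in the given
state within the image of the given symbol. -/
abbrev Announcement (S : RankedAlphabet.{u}) (Q : Type w) (N : ℕ) : Type (max u w) :=
  Q × (s : S.Sym) × (Fin (S.rank s) → Demand Q N)

/-- A word that has still to be executed. -/
abbrev Residue (S : RankedAlphabet.{u}) (Q : Type w) (N : ℕ) : Type (max u w) :=
  Word Q N × Option (Announcement S Q N)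

/-- The state `some (x, q, y)` stands for the state `q` with the residue `x` when it is on top of
the stack, and the residue `y` when it is popped. The state `none` generates all trees. -/
abbrev InvState (S : RankedAlphabet.{u}) (Q : Type w) (N : ℕ) : Type (max u w) :=
  Option (Residue S Q N × Q × Residue S Q N)

def emptyWord : Word Q N := ⟨[], Nat.zero_le N⟩

def idle : Residue S Q N := (emptyWord, none)

def Demand.state : Demand Q N → InvState S Q N
  | none => none
  | some (p, q) => some ((p, none), q, idle)

variable (P : PushdownTreeSystem D Q) (h : TreeHom S D)

/-- Here the residue guessed at a push is checked: it must equal the present one. -/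
inductive InvPop : InvState S Q N → Prop
  | pop {q x} (hq : P.pop q) : InvPop (some (x, q, x))

/-- `step` executes one letter of the residue. `announce` prepares a symbol in whose image the stack
is dropped. -/
inductive InvMove : InvState S Q N → InvState S Q N → Prop
  | move {q a x y} (hq : P.move q a) : InvMove (some (x, q, y)) (some (x, a, y))
  | step {q a y} {p p' : Word Q N} {e : Option (Announcement S Q N)}
      (hp : p.1 = (q, a) :: p'.1) : InvMove (some ((p, e), q, y)) (some ((p', e), a, y))
  | announce {s ξ a q y} {p : Word Q N} (hr : P.Reads ξ (h s) p.1 (.inr a)) :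
      InvMove (some (idle, q, y)) (some ((p, some (a, ⟨s, ξ⟩)), q, y))

inductive InvPush : InvState S Q N → InvState S Q N → InvState S Q N → Prop
  | push {q a b x y} (z) (hq : P.push q a b) :
      InvPush (some (x, q, y)) (some (x, a, z)) (some (z, b, y))

/-- In `inherit`, child `i` gets the word as residue together with the stack, hence no further
demand. In `discard`, the announced word is used up and the announced state is on top. -/
inductive InvRead : InvState S Q N → (s : S.Sym) → Option (Fin (S.rank s)) →
    (Fin (S.rank s) → InvState S Q N) → Prop
  | all (s) : InvRead none s none fun _ => none
  | inherit {s ξ i q y} {p : Word Q N} (hr : P.Reads ξ (h s) p.1 (.inl i)) (hi : ξ i = none) :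
      InvRead (some (idle, q, y)) s (some i)
        (Function.update (fun j => (ξ j).state) i (some ((p, none), q, y)))
  | discard {s ξ a y} :
      InvRead (some ((emptyWord, some (a, ⟨s, ξ⟩)), a, y)) s none fun j => (ξ j).state

/-- The pushdown tree system for the inverse image under a tree homomorphism. -/
def inverse (N : ℕ) : PushdownTreeSystem S (InvState S Q N) where
  start := some (idle, P.start, idle)
  pop := P.InvPop
  move := P.InvMove h
  push := P.InvPush
  read := P.InvRead h

/-- The stack `l` is annotated with residues, the topmost of which is given. -/
inductive Annotates : List (InvState S Q N) → Residue S Q N → List Q → Prop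
  | nil : Annotates [] idle []
  | cons {L y l} (x q) (hL : Annotates L y l) : Annotates (some (x, q, y) :: L) x (q :: l)

/-- The meaning of an annotated stack with a given topmost residue. -/
def Achieves (l : List Q) (t : GroundTree S) : Residue S Q N → Prop
  | (p, none) => ∃ l', P.Exec l p.1 l' ∧ P.Gen l' (h.apply t)
  | (p, some (a, ⟨s, ξ⟩)) => ∃ l', P.Exec l p.1 (a :: l') ∧
      ∃ ts, t = .node s ts ∧ ∀ j, (ξ j).Holds P (h.apply (ts j))

variable {P h}

theorem Achieves.mono {l l' : List Q} {t : GroundTree S} {p p' : Word Q N} {e}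
    (hl : ∀ m, P.Exec l p.1 m → P.Exec l' p'.1 m) (hA : P.Achieves h l t (p, e)) :
    P.Achieves h l' t (p', e) := by
  rcases e with _ | ⟨a, s, ξ⟩
  · obtain ⟨m, h1, h2⟩ := hA
    exact ⟨m, hl _ h1, h2⟩
  · obtain ⟨m, h1, h2⟩ := hA
    exact ⟨m, hl _ h1, h2⟩

theorem holds_of_achieves {d : Demand Q N} {t : GroundTree S}
    (hd : ∀ x l, Annotates [(d.state : InvState S Q N)] x l → P.Achieves h l t x) :
    d.Holds P (h.apply t) := by
  rcases d with _ | ⟨p, q⟩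
  · trivial
  · exact hd _ _ (.cons _ _ .nil)

/-- Soundness: a transition either extends an execution of `P` or lets `Reads.gen` assemble the run
on the image of a symbol. The state `none` admits no annotation, so `all` is vacuous. -/
theorem achieves_of_gen {L : List (InvState S Q N)} {t : GroundTree S}
    (ht : (P.inverse h N).Gen L t) :
    ∀ x l, Annotates L x l → P.Achieves h l t x := by
  induction ht with
  | pop hq ht ih =>
    rintro x l hl
    cases hq with
    | pop hq =>
      cases hl with
      | cons x q hl => exact (ih _ _ hl).mono fun m hm => .pop hq hm
  | move hq ht ih =>
    rintro x l hl
    cases hq with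
    | move hq =>
      cases hl with
      | cons x q hl => exact (ih _ _ (.cons _ _ hl)).mono fun m hm => .move hq hm
    | step hp =>
      cases hl with
      | cons x q hl => exact (ih _ _ (.cons _ _ hl)).mono fun m hm => hp ▸ .step hm
    | announce hr =>
      cases hl with
      | cons x q hl =>
        obtain ⟨m, h1, ts, rfl, h2⟩ := ih _ _ (.cons _ _ hl)
        exact ⟨_, .refl _, hr.gen h2 h1 ⟨m, rfl⟩⟩
  | push hq ht ih =>
    rintro x l hl
    cases hq with
    | push z hq =>
      cases hl with
      | cons x q hl => exact (ih _ _ (.cons _ _ (.cons _ _ hl))).mono fun m hm => .push hq hm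
  | @read q s i qs l ts hq ht ih =>
    rintro x l hl
    cases hq with
    | all => cases hl
    | @inherit _ ξ i _ _ p hr hi =>
      cases hl with
      | cons x q hl =>
        have hi' := ih i
        rw [if_pos rfl, Function.update_self] at hi'
        obtain ⟨m, h1, h2⟩ := hi' _ _ (.cons _ _ hl)
        refine ⟨_, .refl _, hr.gen (fun j => ?_) h1 h2⟩
        by_cases hj : j = i
        · subst hj
          rw [hi]
          trivial
        · have hj' := ih j
          rw [if_neg (by simpa using Ne.symm hj), Function.update_of_ne hj] at hj'
          exact holds_of_achieves hj'
    | discard =>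
      cases hl with
      | cons x q hl => exact ⟨_, .refl _, ts, rfl, fun j => holds_of_achieves (ih j)⟩

theorem gen_all (t : GroundTree S) (L : List (InvState S Q N)) :
    (P.inverse h N).Gen (none :: L) t := by
  induction t generalizing L with
  | var x => exact x.elim0
  | node s ts ih => exact .read (i := none) (.all s) fun j => ih j _

theorem Annotates.exists_cons {L : List (InvState S Q N)} {x q l}
    (hL : Annotates L x (q :: l)) : ∃ y L', L = some (x, q, y) :: L' ∧ Annotates L' y l := by
  cases hL with
  | cons _ _ hL => exact ⟨_, _, rfl, hL⟩

/-- For the part of a stack that is about to be dropped, where any annotation will do. -/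
theorem exists_annotates (l : List Q) : ∃ L : List (InvState S Q N), Annotates L idle l := by
  induction l with
  | nil => exact ⟨_, .nil⟩
  | cons q l ih => obtain ⟨L, hL⟩ := ih; exact ⟨_, .cons _ _ hL⟩

/-- Prepending a run to an annotated stack. -/
theorem Exec.exists_gen {l p l'} {t : GroundTree S} {e} (hl : P.Exec l p l') (hp : p.length ≤ N)
    (ht : ∃ L, Annotates L (emptyWord, e) l' ∧ (P.inverse h N).Gen L t) :
    ∃ L, Annotates L (⟨p, hp⟩, e) l ∧ (P.inverse h N).Gen L t := by
  induction hl with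
  | refl l => exact ht
  | pop hq hl ih =>
    obtain ⟨L, h1, h2⟩ := ih hp ht
    exact ⟨_, .cons _ _ h1, .pop (.pop hq) h2⟩
  | move hq hl ih =>
    obtain ⟨L, h1, h2⟩ := ih hp ht
    obtain ⟨y, L, rfl, h3⟩ := h1.exists_cons
    exact ⟨_, .cons _ _ h3, .move (.move hq) h2⟩
  | push hq hl ih =>
    obtain ⟨L, h1, h2⟩ := ih hp ht
    obtain ⟨y, L, rfl, h3⟩ := h1.exists_cons
    obtain ⟨z, L, rfl, h4⟩ := h3.exists_cons
    -- The guessed residue is read off from the annotation of the remaining run.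
    exact ⟨_, .cons _ _ h4, .push (.push _ hq) h2⟩
  | step hl ih =>
    obtain ⟨L, h1, h2⟩ := ih (Nat.le_of_succ_le hp) ht
    obtain ⟨y, L, rfl, h3⟩ := h1.exists_cons
    exact ⟨_, .cons _ _ h3, .move (.step rfl) h2⟩

theorem exists_gen (hlin : h.IsLinear) (hN : ∀ s, (h s).height ≤ N) (t : GroundTree S) :
    ∀ l, P.Gen l (h.apply t) →
      ∃ L, Annotates L idle l ∧ (P.inverse h N).Gen L t := by
  induction t with
  | var x => exact x.elim0
  | node s ts ih =>
    intro l hl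
    obtain ⟨p, e, l', h1, h2, h3⟩ := exists_reads hl (hlin s) (hN s) rfl
    -- The end variable carries no demand, since its child inherits the stack.
    obtain ⟨ξ, h4, h5, h6⟩ := h3 none fun _ _ => trivial
    have hp : p.length ≤ N := h4.length_le.trans (hN s)
    have hξ : ∀ j, (P.inverse h N).Gen [(ξ j).state] (ts j) := by
      intro j
      have h7 := h6 j
      rcases hj : ξ j with _ | ⟨w, q⟩
      · exact gen_all _ _
      · rw [hj] at h7
        obtain ⟨m, h8, h9⟩ := h7
        obtain ⟨L, h10, h11⟩ := h8.exists_gen (h := h) w.2 (ih j m h9)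
        obtain ⟨y, L, rfl, h12⟩ := h10.exists_cons
        cases h12
        exact h11
    cases e with
    | inl i =>
      obtain ⟨L, h7, h8⟩ := h1.exists_gen (h := h) hp (ih i l' h2)
      cases h7 with
      | nil => exact absurd h8 (not_gen_nil _ _)
      | cons x q h7 =>
        refine ⟨_, .cons _ _ h7, .read (.inherit (p := ⟨p, hp⟩) h4 (h5 i rfl)) fun j => ?_⟩
        by_cases hj : j = i
        · subst hj
          rwa [if_pos rfl, Function.update_self]
        · rw [if_neg (by simpa using Ne.symm hj), Function.update_of_ne hj]
          exact hξ j
    | inr a =>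
      obtain ⟨m, rfl⟩ := h2
      -- Built backwards: the final read of `s`, before it the execution of the word, before that
      -- the announcement.
      obtain ⟨L, hL⟩ := exists_annotates (S := S) (N := N) m
      obtain ⟨L, h7, h8⟩ := h1.exists_gen (h := h) (e := some (a, ⟨s, ξ⟩)) hp
        ⟨_, .cons _ _ hL, .read (.discard) hξ⟩
      cases h7 with
      | cons x q h7 => exact ⟨_, .cons _ _ h7, .move (.announce h4) h8⟩

theorem language_inverse (hlin : h.IsLinear) (hN : ∀ s, (h s).height ≤ N) :
    (P.inverse h N).language = {t | h.apply t ∈ P.language} := by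
  ext t
  constructor
  · intro ht
    obtain ⟨l, h1, h2⟩ := achieves_of_gen ht _ _ (.cons _ _ .nil)
    exact h1.gen rfl h2
  · intro ht
    obtain ⟨L, h1, h2⟩ := exists_gen hlin hN t _ ht
    obtain ⟨y, L, rfl, h3⟩ := h1.exists_cons
    cases h3
    exact h2

instance [Finite Q] : Finite (Word Q N) := by
  have : Finite {p : List (Q × Q) | p.length ≤ N} := List.finite_length_le (Q × Q) N
  exact this

end PushdownTreeSystem

theorem TreeHom.exists_height_le {S : RankedAlphabet.{u}} {D : RankedAlphabet.{v}}
    (h : TreeHom S D) : ∃ N, ∀ s, (h s).height ≤ N := by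
  have := S.finite_sym
  obtain ⟨N, hN⟩ := (Set.finite_range fun s => (h s).height).bddAbove
  exact ⟨N, fun s => hN ⟨s, rfl⟩⟩

theorem mainTheorem2 {S : RankedAlphabet.{u}} {D : RankedAlphabet.{v}}
    (h : TreeHom S D) (hlin : h.IsLinear)
    (L : Set (GroundTree D)) (hL : IsLinearMonadicCFTL L) :
    IsLinearMonadicCFTL {t : GroundTree S | h.apply t ∈ L} := by
  obtain ⟨Q, _, P, rfl⟩ := isLinearMonadicCFTL_iff.1 hL
  obtain ⟨N, hN⟩ := h.exists_height_le
  -- Announcements contain symbols of `S`, so the finiteness of the state set depends on this.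
  have := S.finite_sym
  rw [← PushdownTreeSystem.language_inverse hlin hN]
  exact (P.inverse h N).isLinearMonadicCFTL
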